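/- Let $n\ge 2$, let $\bar B^n$ be the closed unit ball of $\mathbb R^n$, and let $E\subset S^{n-1}$ be a nonempty, relatively open subset of the unit sphere. A broken ray with endpoints in $E$ is a polygonal path in $\bar B^n$ with finitely many (at least one) segments of positive length whose vertices lie on $S^{n-1}$, which starts and ends at points of $E$, and which is reflected at each intermediate vertex so that the angle of incidence equals the angle of reflection (intermediate reflections at points of $E$ are allowed). The broken ray transform of $f:\bar B^n\to\mathbb R$ assigns to each broken ray $\gamma$ with endpoints in $E$ the average $\mathcal Gf(\gamma)=\frac1{\ell(\gamma)}\int_\gamma f\,d\mathcal H^1$, where $\ell(\gamma)$ is the length of $\gamma$. **Definitions.** A *quasianalytic sequence* is an increasing, logarithmically convex sequence $M=(M_m)_{m\ge0}$ of positive reals with $\sum_{m}\sqrt{M_m/M_{m+1}}=\infty$. A $2\pi$-periodic function $g$ is in $C^\#(M)$ with constant $\rho>0$ if $g(\theta)=\sum_{k\ge0}(a_k\cos k\theta+b_k\sin k\theta)$ uniformly in $\theta$, with $\sum_{k\ge1}k^{2m}|a_k|^2\le M_m\rho^m$ and $\sum_{k\ge1}k^{2m}|b_k|^2\le M_m\rho^m$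 for all $m\ge0$. A function $f:\bar B^n\to\mathbb R$ is *uniformly quasianalytic in the angular variables* if for every two-dimensional linear subspace $F\subset\mathbb R^n$ the restriction of $f$ to the disk $\bar B^n\cap F$, with polar coordinates $(r,\theta)$ in $F$, is continuous and for every $R\in(0,1]$ there are a quasianalytic sequence $M=M^{F,R}$ and a constant $\rho>0$ such that for all $r\in[R,1]$ the function $f(r,\cdot)$ is in $C^\#(M)$ with constant $\rho$. *The angular derivatives of $f$ satisfy the Dini–Lipschitz condition* if for every such $F$ the derivatives $\partial_\theta^m(f|_{\bar B^n\cap F})$ of all orders $m\ge0$ exist and each has a modulus of continuity $\omega$ on $\bar B^n\cap F$ with $\omega(\delta)=o(1/\log(1/\delta))$ as $\delta\to0^+$. **Statement.** Integrals over the broken rays with endpoints in $E$ determine such functions uniquely: 1. If $f:\bar B^n\to\mathbb R$ is uniformly quasianalytic in the angular variables, its angular derivatives satisfy the Dini–Lipschitz condition, and $\mathcal Gf(\gamma)=0$ for every broken ray $\gamma$ with endpoints in $E$, then $f=0$ on $\bar B^n$. 2. If $f,g:\bar B^n\to\mathbb R$ are uniformly quasianalytic in the angular variables with the same sequences $M^{F,R}$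 (the constants $\rho$ may differ), the angular derivatives of both satisfy the Dini–Lipschitz condition, and $\mathcal Gf(\gamma)=\mathcal Gg(\gamma)$ for every broken ray $\gamma$ with endpoints in $E$, then $f=g$ on $\bar B^n$. -/

import Mathlib

open Filter Topology
open scoped ENNReal ContDiff

noncomputable section

namespace BrokenRayTomography

/-- Euclidean space of dimension `n`. -/
abbrev Space (n : ℕ) : Type := EuclideanSpace ℝ (Fin n)

/-- The unit sphere, i.e. the boundary of the unit ball. -/
abbrev UnitSphere (n : ℕ) : Type := Metric.sphere (0 : Space n) 1

/-! ### Broken rays and the broken ray transform in the unit ball -/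

/-- The unit direction vector of the segment from `x` to `y`. -/
def direction {n : ℕ} (x y : Space n) : Space n := ‖y - x‖⁻¹ • (y - x)

/-- A broken ray in the closed unit ball with both endpoints in the set of tomography `E`:
a polygonal path with vertices `vertex 0, …, vertex segments` on the unit sphere, which is reflected
according to geometric optics at every intermediate vertex (the normal of the sphere at `x` is `x`).
Reflections on `E` are allowed. The values `vertex i` with `segments < i` play no role. -/
structure BrokenRay (n : ℕ) (E : Set (UnitSphere n)) where
  segments : ℕ
  segments_pos : 0 < segments
  vertex : ℕ → UnitSphere n
  start_mem : vertex 0 ∈ E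
  end_mem : vertex segments ∈ E
  nondegenerate : ∀ i < segments, vertex i ≠ vertex (i + 1)
  reflection_law : ∀ i, i + 1 < segments →
    direction (vertex (i + 1) : Space n) (vertex (i + 2)) =
      direction (vertex i : Space n) (vertex (i + 1)) -
        (2 * inner ℝ (direction (vertex i : Space n) (vertex (i + 1))) (vertex (i + 1) : Space n)) •
          (vertex (i + 1) : Space n)

/-- The length of the `i`-th segment. -/
def BrokenRay.segmentLength {n : ℕ} {E : Set (UnitSphere n)} (γ : BrokenRay n E) (i : ℕ) : ℝ :=
  ‖(γ.vertex (i + 1) : Space n) - γ.vertex i‖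

/-- The total length of a broken ray. -/
def BrokenRay.length {n : ℕ} {E : Set (UnitSphere n)} (γ : BrokenRay n E) : ℝ :=
  ∑ i ∈ Finset.range γ.segments, γ.segmentLength i

/-- The broken ray transform: the average of `f` over the broken ray with respect to arc length. -/
def brokenRayTransform {n : ℕ} {E : Set (UnitSphere n)} (f : Space n → ℝ) (γ : BrokenRay n E) : ℝ :=
  (1 / γ.length) * ∑ i ∈ Finset.range γ.segments,
    ∫ t in (0 : ℝ)..(γ.segmentLength i),
      f ((γ.vertex i : Space n) + t • direction (γ.vertex i : Space n) (γ.vertex (i + 1)))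

/-! ### Quasianalytic classes -/

/-- `M` is an increasing, logarithmically convex sequence of positive numbers with
`∑ √(M n / M (n + 1)) = ∞`, i.e. it defines a quasianalytic class. -/
structure IsQuasianalyticSeq (M : ℕ → ℝ) : Prop where
  pos : ∀ n, 0 < M n
  mono : Monotone M
  logConvex : ∀ n, 2 * Real.log (M (n + 1)) ≤ Real.log (M n) + Real.log (M (n + 2))
  diverges : ¬ Summable fun n => Real.sqrt (M n / M (n + 1))

/-- The sequence `(a k)`, `k ≥ 1`, is in the class `S^#(M)` with constant `ρ`:
`∑_{k ≥ 1} k ^ (2 n) |a k| ^ 2 ≤ M n * ρ ^ n` for all `n`. -/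
def SeqClassBound (M : ℕ → ℝ) (ρ : ℝ) (a : ℕ → ℝ) : Prop :=
  ∀ n : ℕ, Summable (fun k : ℕ => ((k + 1 : ℕ) : ℝ) ^ (2 * n) * |a (k + 1)| ^ 2) ∧
    ∑' k : ℕ, ((k + 1 : ℕ) : ℝ) ^ (2 * n) * |a (k + 1)| ^ 2 ≤ M n * ρ ^ n

/-- The function `g` is in the class `C^#(M)` with constant `ρ`: it is the sum of a uniformly
convergent trigonometric series whose coefficients are in `S^#(M)` with constant `ρ`. -/
def FunClassBound (M : ℕ → ℝ) (ρ : ℝ) (g : ℝ → ℝ) : Prop :=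
  ∃ a b : ℕ → ℝ,
    TendstoUniformly
      (fun (K : ℕ) (x : ℝ) =>
        ∑ k ∈ Finset.range (K + 1), (a k * Real.cos (k * x) + b k * Real.sin (k * x)))
      g atTop ∧
    SeqClassBound M ρ a ∧ SeqClassBound M ρ b

/-! ### Angular regularity in the disk -/

/-- The point of the plane with polar coordinates `(r, θ)`. -/
def polarPoint (r θ : ℝ) : Space 2 := !₂[r * Real.cos θ, r * Real.sin θ]

/-- `f` is continuous on the closed unit disk and, for each `R ∈ (0, 1]`, the functions `f(r, ·)` with
`R ≤ r ≤ 1` belong, uniformly, to the quasianalytic class of functions defined by the sequence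
`M R`. -/
def UniformlyQuasianalyticDiskIn (M : ℝ → ℕ → ℝ) (f : Space 2 → ℝ) : Prop :=
  ContinuousOn f (Metric.closedBall 0 1) ∧
    ∀ R : ℝ, 0 < R → R ≤ 1 → IsQuasianalyticSeq (M R) ∧
      ∃ ρ : ℝ, 0 < ρ ∧ ∀ r : ℝ, R ≤ r → r ≤ 1 →
        FunClassBound (M R) ρ (fun θ => f (polarPoint r θ))

/-- The rotation of the plane by the angle `φ`. -/
def rotate (φ : ℝ) (x : Space 2) : Space 2 :=
  !₂[Real.cos φ * x 0 - Real.sin φ * x 1, Real.sin φ * x 0 + Real.cos φ * x 1]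

/-- The angular derivative of order `m` (with respect to the polar angle). -/
def angularDeriv (m : ℕ) (f : Space 2 → ℝ) (x : Space 2) : ℝ :=
  iteratedDeriv m (fun φ => f (rotate φ x)) 0

/-- The modulus of continuity of `g` on the set `K`. -/
def modulusOfContinuity (K : Set (Space 2)) (g : Space 2 → ℝ) (δ : ℝ) : ℝ≥0∞ :=
  ⨆ x ∈ K, ⨆ y ∈ K, ⨆ _ : dist x y ≤ δ, ENNReal.ofReal |g x - g y|

/-- The Dini-Lipschitz condition on `K`: `ω(δ) = o(1 / log (1 / δ))` as `δ → 0+`. -/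
def DiniLipschitzOn (K : Set (Space 2)) (g : Space 2 → ℝ) : Prop :=
  Tendsto (fun δ : ℝ => modulusOfContinuity K g δ * ENNReal.ofReal (Real.log (1 / δ)))
    (𝓝[>] 0) (𝓝 0)

/-- The angular derivatives of `f` of all orders `m ≥ 0` exist and satisfy the Dini-Lipschitz
condition in the closed unit disk. -/
def AngularDiniLipschitzDisk (f : Space 2 → ℝ) : Prop :=
  (∀ x ∈ Metric.closedBall (0 : Space 2) 1, ContDiff ℝ ∞ fun φ => f (rotate φ x)) ∧
    ∀ m : ℕ, DiniLipschitzOn (Metric.closedBall 0 1) (angularDeriv m f)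

/-! ### Angular regularity in the ball: restrictions to planes through the origin

A plane `F` through the origin is identified with `ℝ²` by means of a linear isometry `L` with
range `F`; which one is used (the choice of the polar axis and of the orientation of `F`) is
immaterial. -/

/-- The restriction of `f` to each plane `F` through the origin is uniformly quasianalytic in the
angular variable, with the quasianalytic classes given by the sequences `M F R`, `0 < R ≤ 1`. -/
def UniformlyQuasianalyticIn {n : ℕ} (M : Submodule ℝ (Space n) → ℝ → ℕ → ℝ)
    (f : Space n → ℝ) : Prop :=
  ∀ F : Submodule ℝ (Space n), Module.finrank ℝ F = 2 →
    ∃ L : Space 2 →ₗᵢ[ℝ] Space n, LinearMap.range L.toLinearMap = F ∧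
      UniformlyQuasianalyticDiskIn (M F) (f ∘ L)

/-- `f` is uniformly quasianalytic in the angular variables. -/
def UniformlyQuasianalytic {n : ℕ} (f : Space n → ℝ) : Prop :=
  ∃ M : Submodule ℝ (Space n) → ℝ → ℕ → ℝ, UniformlyQuasianalyticIn M f

/-- The angular derivatives of all orders, in each plane through the origin, satisfy the
Dini-Lipschitz condition. -/
def AngularDiniLipschitz {n : ℕ} (f : Space n → ℝ) : Prop :=
  ∀ F : Submodule ℝ (Space n), Module.finrank ℝ F = 2 →
    ∃ L : Space 2 →ₗᵢ[ℝ] Space n, LinearMap.range L.toLinearMap = F ∧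
      AngularDiniLipschitzDisk (f ∘ L)

end BrokenRayTomography

end

/-!
Restriction to a plane through a given point of the ball and a point of `E` reduces the theorem to
the disk, and linearity reduces it to showing that a function `h` on the disk is zero if its
integrals over the broken rays with endpoints in an open set `U` of the circle vanish. The function
`h` is the difference of two functions of the same quasianalytic classes.

In the disk, the broken ray that starts at the angle `θ` and consists of `N` chords of angle `β` has
the vertices `θ, θ + β, …, θ + N β`, and its transform is the mean of `I (θ + k β)`, `k < N`, where
`I φ` is the average of `h` over the chord from `φ` to `φ + β` (`exists_brokenRay`). A chord that
does not meet the centre stays in an annulus `R ≤ r ≤ 1`, so `I` is an average of turned copies of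
the functions `h (r, ·)`, `R ≤ r ≤ 1`, and belongs to a quasianalytic class
(`exists_derivBound_chordAverage`).

Let `β` be an irrational multiple of `2 π`. Some multiple `N β` is close to a multiple of `2 π`, so
that `∑ k < N, I (θ + k β) = 0` for all `θ` in some open set. By the Denjoy–Carleman theorem
(`DerivBound.eq_zero`, by Bang's elementary argument) the sum vanishes for all `θ`. Comparing the
sums for `θ` and `θ + β` shows that `I` has the period `N β`, besides `2 π`; the two generate a
dense group, so `I` is constant, and then zero (`eq_zero_of_sum_rotation_eq_zero`). Hence the
integrals of `h` over all chords at all but countably many distances from the centre vanish, and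
`h = 0` since the Fourier transform of the extension of `h` by zero vanishes
(`eq_zero_of_chordAverage_eq_zero`).
-/

noncomputable section

namespace BrokenRayTomography

open MeasureTheory
open scoped FourierTransform

/-! ### The Denjoy–Carleman theorem -/

/-- `G` is the sequence of successive derivatives of the smooth function `G 0`. -/
def IsDerivSeq (G : ℕ → ℝ → ℝ) : Prop :=
  ∀ m x, HasDerivAt (G m) (G (m + 1) x) x

/-- `g` is smooth, and its derivative of order `m` is bounded by `B m` on the whole line. -/
def DerivBound (B : ℕ → ℝ) (g : ℝ → ℝ) : Prop :=
  ∃ G : ℕ → ℝ → ℝ, G 0 = g ∧ IsDerivSeq G ∧ ∀ m x, |G m x| ≤ B m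

/-- `B` is a logarithmically convex sequence of bounds for derivatives that satisfies the
Denjoy–Carleman condition `∑ B m / B (m + 1) = ∞`. -/
structure IsDenjoyCarlemanSeq (B : ℕ → ℝ) : Prop where
  pos : ∀ m, 0 < B m
  logConvex : ∀ m, B (m + 1) ^ 2 ≤ B m * B (m + 2)
  diverges : ¬ Summable fun m => B m / B (m + 1)

lemma IsDerivSeq.shift {G : ℕ → ℝ → ℝ} (hG : IsDerivSeq G) (j : ℕ) :
    IsDerivSeq fun m => G (j + m) :=
  fun m x => hG (j + m) x

/-- Taylor's formula as an estimate: only absolute values of the derivatives at `x` enter. -/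
lemma IsDerivSeq.abs_add_le {G : ℕ → ℝ → ℝ} (hG : IsDerivSeq G) {n : ℕ} {C : ℝ}
    (hC : ∀ x, |G n x| ≤ C) (x : ℝ) {h : ℝ} (hh : 0 ≤ h) :
    |G 0 (x + h)| ≤
      ∑ i ∈ Finset.range n, |G i x| * (h ^ i / i.factorial) + C * (h ^ n / n.factorial) := by
  induction n generalizing G h with
  | zero => simpa using hC (x + h)
  | succ n ih =>
    have hmono (i : ℕ) (s : ℝ) : HasDerivAt (fun s : ℝ => s ^ (i + 1) / ((i + 1).factorial : ℝ))
        (s ^ i / i.factorial) s := by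
      refine ((hasDerivAt_pow (i + 1) s).div_const ((i + 1).factorial : ℝ)).congr_deriv ?_
      rw [Nat.factorial_succ]
      push_cast
      have : (i.factorial : ℝ) ≠ 0 := by positivity
      field_simp
    have hf (s : ℝ) : HasDerivAt (fun s => G 0 (x + s)) (G 1 (x + s)) s := by
      simpa using (hG 0 (x + s)).comp_const_add x s
    have hp (s : ℝ) : HasDerivAt (fun s : ℝ => |G 0 x| +
        (∑ i ∈ Finset.range n, |G (1 + i) x| * (s ^ (i + 1) / (i + 1).factorial) +
          C * (s ^ (n + 1) / (n + 1).factorial)))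
        (∑ i ∈ Finset.range n, |G (1 + i) x| * (s ^ i / i.factorial) +
          C * (s ^ n / n.factorial)) s := by
      refine HasDerivAt.const_add _ (HasDerivAt.add ?_ ((hmono n s).const_mul C))
      exact HasDerivAt.fun_sum fun i _ => (hmono i s).const_mul _
    have key := image_norm_le_of_norm_deriv_right_le_deriv_boundary (a := 0) (b := h)
      (f := fun s => G 0 (x + s)) (fun s _ => (hf s).continuousAt.continuousWithinAt)
      (fun s _ => (hf s).hasDerivWithinAt) (by simp) hp
      (fun s hs => by
        have := ih (hG.shift 1) (fun x => by simpa [add_comm] using hC x) hs.1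
        simpa using this) (Set.right_mem_Icc.mpr hh)
    refine key.trans (le_of_eq ?_)
    rw [Finset.sum_range_succ']
    simp only [add_comm 1, pow_zero, Nat.factorial_zero]
    simp
    ring

lemma IsDenjoyCarlemanSeq.ratio_mono {B : ℕ → ℝ} (hB : IsDenjoyCarlemanSeq B) :
    Monotone fun m => B (m + 1) / B m := by
  refine monotone_nat_of_le_succ fun m => ?_
  rw [div_le_div_iff₀ (hB.pos _) (hB.pos _)]
  nlinarith [hB.logConvex m]

lemma IsDenjoyCarlemanSeq.le_mul_pow {B : ℕ → ℝ} (hB : IsDenjoyCarlemanSeq B) {K j i : ℕ}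
    (h : j + i ≤ K + 1) : B (j + i) ≤ B j * (B (K + 1) / B K) ^ i := by
  induction i with
  | zero => simp
  | succ i ih =>
    have h1 := ih (by omega)
    have h2 : B (j + i + 1) / B (j + i) ≤ B (K + 1) / B K := hB.ratio_mono (by omega)
    have h3 : B (j + i + 1) = B (j + i) * (B (j + i + 1) / B (j + i)) := by
      have := (hB.pos (j + i)).ne'
      field_simp
    rw [← add_assoc, h3, pow_succ, ← mul_assoc]
    have := hB.pos (j + i)
    have := hB.pos (j + i + 1)
    exact mul_le_mul h1 h2 (by positivity) (h1.trans' (hB.pos _).le)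

/-- The step of Bang's argument: on an interval of length `B K / (e B (K + 1))` the derivatives,
measured in units of `e ^ j B j`, grow by a factor of at most `e`. -/
lemma IsDerivSeq.bang_step {G : ℕ → ℝ → ℝ} (hG : IsDerivSeq G) {B : ℕ → ℝ}
    (hB : IsDenjoyCarlemanSeq B) (hGB : ∀ m x, |G m x| ≤ B m) {K : ℕ} {x h : ℝ}
    (hx : ∀ j, |G j x| ≤ Real.exp ((j : ℝ) - (K + 1 : ℕ)) * B j) (hh : 0 ≤ h)
    (hhK : h ≤ Real.exp (-1) * (B K / B (K + 1))) (j : ℕ) :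
    |G j (x + h)| ≤ Real.exp ((j : ℝ) - K) * B j := by
  rcases le_or_gt K j with hj | hj
  · refine (hGB j _).trans (le_mul_of_one_le_left (hB.pos j).le (Real.one_le_exp ?_))
    have : (K : ℝ) ≤ j := by exact_mod_cast hj
    linarith
  obtain ⟨n, hn⟩ : ∃ n, K + 1 = j + n := ⟨K + 1 - j, by omega⟩
  set q := B (K + 1) / B K with hq
  have hq0 : 0 < q := div_pos (hB.pos _) (hB.pos _)
  have hBj := hB.pos j
  set y := Real.exp 1 * h * q with hy
  have hy0 : 0 ≤ y := by positivity
  have hy1 : y ≤ 1 := by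
    calc y ≤ Real.exp 1 * (Real.exp (-1) * (B K / B (K + 1))) * q := by
          rw [hy]; gcongr
      _ = (Real.exp 1 * Real.exp (-1)) * (B K / B (K + 1) * (B (K + 1) / B K)) := by
          rw [hq]; ring
      _ = 1 := by
          have := (hB.pos K).ne'
          have := (hB.pos (K + 1)).ne'
          rw [← Real.exp_add]
          field_simp
          simp
  have hterm (i : ℕ) (hi : j + i ≤ K + 1) :
      Real.exp (((j + i : ℕ) : ℝ) - (K + 1 : ℕ)) * B (j + i) * (h ^ i / i.factorial) ≤
        Real.exp ((j : ℝ) - (K + 1 : ℕ)) * B j * (y ^ i / i.factorial) := by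
    have h1 := hB.le_mul_pow hi
    calc _ ≤ Real.exp (((j + i : ℕ) : ℝ) - (K + 1 : ℕ)) * (B j * q ^ i) *
            (h ^ i / i.factorial) := by gcongr
      _ = _ := by
        have : ((j + i : ℕ) : ℝ) - (K + 1 : ℕ) = ((j : ℝ) - (K + 1 : ℕ)) + i * 1 := by
          push_cast; ring
        rw [this, Real.exp_add, Real.exp_nat_mul, hy]
        ring
  have htaylor := (hG.shift j).abs_add_le (n := n) (C := B (K + 1))
    (fun x => hn ▸ hGB (j + n) x) x hh
  calc |G j (x + h)| ≤ ∑ i ∈ Finset.range n, |G (j + i) x| * (h ^ i / i.factorial) +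
        B (K + 1) * (h ^ n / n.factorial) := by simpa using htaylor
    _ ≤ ∑ i ∈ Finset.range n,
          Real.exp ((j : ℝ) - (K + 1 : ℕ)) * B j * (y ^ i / i.factorial) +
        Real.exp ((j : ℝ) - (K + 1 : ℕ)) * B j * (y ^ n / n.factorial) := by
      refine add_le_add (Finset.sum_le_sum fun i hi => ?_) ?_
      · refine (mul_le_mul_of_nonneg_right (hx (j + i)) (by positivity)).trans
          (hterm i ?_)
        have := Finset.mem_range.mp hi
        omega
      · refine le_trans (le_of_eq ?_) (hterm n hn.ge)
        rw [← hn]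
        simp
    _ = Real.exp ((j : ℝ) - (K + 1 : ℕ)) * B j *
          ∑ i ∈ Finset.range (n + 1), y ^ i / i.factorial := by
      rw [Finset.sum_range_succ, mul_add, Finset.mul_sum]
    _ ≤ Real.exp ((j : ℝ) - (K + 1 : ℕ)) * B j * Real.exp 1 := by
      gcongr
      exact (Real.sum_le_exp_of_nonneg hy0 _).trans (Real.exp_le_exp.mpr hy1)
    _ = Real.exp ((j : ℝ) - K) * B j := by
      rw [mul_right_comm, ← Real.exp_add]
      congr 2
      push_cast
      ring

/-- Iteration of the step of Bang's argument, down from the index `K + l` to the index `K`. -/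
lemma IsDerivSeq.bang_iterate {G : ℕ → ℝ → ℝ} (hG : IsDerivSeq G) {B : ℕ → ℝ}
    (hB : IsDenjoyCarlemanSeq B) (hGB : ∀ m x, |G m x| ≤ B m) {K l : ℕ} {x h : ℝ}
    (hx : ∀ j, |G j x| ≤ Real.exp ((j : ℝ) - (K + l : ℕ)) * B j) (hh : 0 ≤ h)
    (hhK : h ≤ Real.exp (-1) * ∑ i ∈ Finset.range l, B (K + i) / B (K + i + 1)) (j : ℕ) :
    |G j (x + h)| ≤ Real.exp ((j : ℝ) - K) * B j := by
  induction l generalizing x h with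
  | zero =>
    have : h = 0 := le_antisymm (by simpa using hhK) hh
    simpa [this] using hx j
  | succ l ih =>
    set d := Real.exp (-1) * (B (K + l) / B (K + l + 1)) with hd
    have hd0 : 0 ≤ d := by
      have := hB.pos (K + l)
      have := hB.pos (K + l + 1)
      positivity
    have hmin : 0 ≤ min h d := le_min hh hd0
    have h1 := ih (x := x + min h d) (h := h - min h d)
      (fun j => hG.bang_step hB hGB (K := K + l) hx hmin (min_le_right _ _) j)
      (by linarith [min_le_left h d])
      (by
        rw [Finset.sum_range_succ, mul_add] at hhK
        rcases min_cases h d with ⟨h2, _⟩ | ⟨h2, _⟩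
        · rw [h2, sub_self]
          refine mul_nonneg (Real.exp_pos _).le (Finset.sum_nonneg fun i _ => ?_)
          exact (div_pos (hB.pos _) (hB.pos _)).le
        · rw [h2]; linarith)
    simpa using h1

lemma IsDerivSeq.eq_zero_of_le {G : ℕ → ℝ → ℝ} (hG : IsDerivSeq G) {B : ℕ → ℝ}
    (hB : IsDenjoyCarlemanSeq B) (hGB : ∀ m x, |G m x| ≤ B m) {x : ℝ}
    (hx : ∀ j, G j x = 0) {y : ℝ} (hxy : x ≤ y) : G 0 y = 0 := by
  have hbound (K : ℕ) : |G 0 y| ≤ Real.exp (-K) * B 0 := by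
    have hnonneg (i : ℕ) : 0 ≤ B (K + i) / B (K + i + 1) :=
      (div_pos (hB.pos _) (hB.pos _)).le
    have hdiv : ¬ Summable fun i => B (K + i) / B (K + i + 1) := by
      have := hB.diverges
      rw [← summable_nat_add_iff K] at this
      simpa only [add_comm _ K] using this
    obtain ⟨l, hl⟩ := ((not_summable_iff_tendsto_nat_atTop_of_nonneg hnonneg).mp
      hdiv).eventually_ge_atTop (Real.exp 1 * (y - x)) |>.exists
    have h1 := hG.bang_iterate hB hGB (K := K) (l := l) (x := x) (h := y - x)
      (fun j => by rw [hx, abs_zero]; exact mul_nonneg (Real.exp_pos _).le (hB.pos j).le)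
      (by linarith)
      (by
        calc y - x = Real.exp (-1) * (Real.exp 1 * (y - x)) := by
              rw [← mul_assoc, ← Real.exp_add]; simp
          _ ≤ _ := by gcongr) 0
    simpa using h1
  have hlim : Tendsto (fun K : ℕ => Real.exp (-(K : ℝ)) * B 0) atTop (𝓝 0) := by
    have := (Real.tendsto_exp_neg_atTop_nhds_zero.comp
      tendsto_natCast_atTop_atTop).mul_const (B 0)
    simpa [Function.comp_def] using this
  exact abs_eq_zero.mp (le_antisymm (ge_of_tendsto' hlim hbound) (abs_nonneg _))

/-- The **Denjoy–Carleman theorem**: a function of a quasianalytic class that vanishes near a point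
vanishes identically. -/
theorem DerivBound.eq_zero {B : ℕ → ℝ} {g : ℝ → ℝ} (hg : DerivBound B g)
    (hB : IsDenjoyCarlemanSeq B) {x : ℝ} (hx : g =ᶠ[𝓝 x] 0) (y : ℝ) : g y = 0 := by
  obtain ⟨G, rfl, hG, hGB⟩ := hg
  have hloc (j : ℕ) : G j =ᶠ[𝓝 x] 0 := by
    induction j with
    | zero => exact hx
    | succ j ih =>
      filter_upwards [ih.eventuallyEq_nhds] with z hz
      have h1 := (hG j z).congr_of_eventuallyEq hz.symm
      exact h1.unique (hasDerivAt_const z 0)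
  rcases le_total x y with hxy | hxy
  · exact hG.eq_zero_of_le hB hGB (fun j => (hloc j).eq_of_nhds) hxy
  -- To the left of `x` the function is reflected.
  · have hG' : IsDerivSeq fun m z => (-1) ^ m * G m (-z) := fun m z => by
      have h1 := ((hG m (-z)).comp z (hasDerivAt_neg z)).const_mul ((-1 : ℝ) ^ m)
      exact h1.congr_deriv (by ring)
    have := hG'.eq_zero_of_le hB (fun m z => by simpa [abs_mul] using hGB m (-z))
      (x := -x) (fun j => by simp [(hloc j).eq_of_nhds]) (neg_le_neg hxy)
    simpa using this

/-! ### Operations on functions with bounded derivatives -/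

lemma DerivBound.mono {B B' : ℕ → ℝ} {g : ℝ → ℝ} (hg : DerivBound B g) (h : ∀ m, B m ≤ B' m) :
    DerivBound B' g := by
  obtain ⟨G, h0, hG, hGB⟩ := hg
  exact ⟨G, h0, hG, fun m x => (hGB m x).trans (h m)⟩

lemma DerivBound.sub {B B' : ℕ → ℝ} {g g' : ℝ → ℝ} (hg : DerivBound B g)
    (hg' : DerivBound B' g') : DerivBound (fun m => B m + B' m) fun x => g x - g' x := by
  obtain ⟨G, rfl, hG, hGB⟩ := hg
  obtain ⟨G', rfl, hG', hGB'⟩ := hg'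
  exact ⟨fun m x => G m x - G' m x, rfl, fun m x => (hG m x).sub (hG' m x),
    fun m x => (abs_sub _ _).trans (add_le_add (hGB m x) (hGB' m x))⟩

lemma DerivBound.comp_affine {B : ℕ → ℝ} {g : ℝ → ℝ} (hg : DerivBound B g) {σ : ℝ}
    (hσ : |σ| = 1) (c : ℝ) : DerivBound B fun x => g (σ * x + c) := by
  obtain ⟨G, rfl, hG, hGB⟩ := hg
  refine ⟨fun m x => σ ^ m * G m (σ * x + c), by simp, fun m x => ?_, fun m x => ?_⟩
  · have h1 : HasDerivAt (fun x => σ * x + c) σ x := by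
      simpa using ((hasDerivAt_id x).const_mul σ).add_const c
    exact (((hG m _).comp x h1).const_mul (σ ^ m)).congr_deriv (by ring)
  · simpa [abs_mul, hσ] using hGB m (σ * x + c)

lemma DerivBound.sum {ι : Type*} {B : ℕ → ℝ} {g : ι → ℝ → ℝ} (s : Finset ι)
    (hg : ∀ i ∈ s, DerivBound B (g i)) :
    DerivBound (fun m => s.card * B m) fun x => ∑ i ∈ s, g i x := by
  choose! G h0 hG hGB using hg
  refine ⟨fun m x => ∑ i ∈ s, G i m x, ?_, fun m x => ?_, fun m x => ?_⟩
  · ext x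
    exact Finset.sum_congr rfl fun i hi => by rw [h0 i hi]
  · exact HasDerivAt.fun_sum fun i hi => hG i hi m x
  · refine (Finset.abs_sum_le_sum_abs _ _).trans ?_
    simp only [← nsmul_eq_mul]
    exact Finset.sum_le_card_nsmul _ _ _ fun i hi => hGB i hi m x

lemma DerivBound.continuous {B : ℕ → ℝ} {g : ℝ → ℝ} (hg : DerivBound B g) : Continuous g := by
  obtain ⟨G, rfl, hG, -⟩ := hg
  exact continuous_iff_continuousAt.mpr fun x => (hG 0 x).continuousAt

/-- Bounds for derivatives are preserved by averaging over a parameter. -/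
lemma DerivBound.integral {T : Type*} [MeasurableSpace T] {μ : Measure T}
    [IsProbabilityMeasure μ] {B : ℕ → ℝ} {F : T → ℝ → ℝ}
    (hF : ∀ t, DerivBound B (F t)) (hmeas : ∀ x, Measurable fun t => F t x) :
    DerivBound B fun x => ∫ t, F t x ∂μ := by
  choose G h0 hG hGB using hF
  -- The derivatives are limits of difference quotients, hence measurable in the parameter.
  have hGmeas (m : ℕ) : ∀ x, Measurable fun t => G t m x := by
    induction m with
    | zero => intro x; simpa [h0] using hmeas x
    | succ m ih =>
      intro x
      refine measurable_of_tendsto_metrizable' (𝓝[≠] (0 : ℝ))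
        (f := fun s t => s⁻¹ • (G t m (x + s) - G t m x)) (fun s => ?_) ?_
      · exact ((ih (x + s)).sub (ih x)).const_smul s⁻¹
      · exact tendsto_pi_nhds.mpr fun t => (hG t m x).tendsto_slope_zero
  have hint (m : ℕ) (x : ℝ) : Integrable (fun t => G t m x) μ :=
    Integrable.of_bound (hGmeas m x).aestronglyMeasurable (B m)
      (Eventually.of_forall fun t => hGB t m x)
  refine ⟨fun m x => ∫ t, G t m x ∂μ, ?_, fun m x => ?_, fun m x => ?_⟩
  · ext x; simp [h0]
  · exact (hasDerivAt_integral_of_dominated_loc_of_deriv_le (F := fun x t => G t m x)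
      (F' := fun x t => G t (m + 1) x) (bound := fun _ => B (m + 1)) (s := Set.univ)
      Filter.univ_mem (Eventually.of_forall fun y => (hGmeas m y).aestronglyMeasurable)
      (hint m x) (hGmeas (m + 1) x).aestronglyMeasurable
      (Eventually.of_forall fun t y _ => hGB t (m + 1) y) (integrable_const _)
      (Eventually.of_forall fun t y _ => hG t m y)).2
  · have := norm_integral_le_of_norm_le_const (μ := μ) (f := fun t => G t m x)
      (C := B m) (Eventually.of_forall fun t => hGB t m x)
    simpa using this

/-! ### Quasianalytic classes of trigonometric series -/

/-- The bounds for derivatives that a quasianalytic sequence `M` gives rise to. The shift of the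
index of `M` accounts for the convergence of the differentiated trigonometric series. -/
def carlemanSeq (M : ℕ → ℝ) (C A : ℝ) (m : ℕ) : ℝ :=
  C * A ^ m * Real.sqrt (M (m + 2))

lemma IsQuasianalyticSeq.isDenjoyCarlemanSeq {M : ℕ → ℝ} (hM : IsQuasianalyticSeq M) {C A : ℝ}
    (hC : 0 < C) (hA : 0 < A) : IsDenjoyCarlemanSeq (carlemanSeq M C A) where
  pos m := by
    have := hM.pos (m + 2)
    unfold carlemanSeq
    positivity
  logConvex m := by
    have h0 := hM.pos (m + 2)
    have h1 := hM.pos (m + 3)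
    have h2 := hM.pos (m + 4)
    have h3 : M (m + 3) ≤ Real.sqrt (M (m + 2)) * Real.sqrt (M (m + 4)) := by
      rw [← Real.sqrt_mul h0.le]
      refine Real.le_sqrt_of_sq_le ?_
      rw [← Real.log_le_log_iff (by positivity) (by positivity), Real.log_pow,
        Real.log_mul h0.ne' h2.ne']
      exact_mod_cast hM.logConvex (m + 2)
    calc carlemanSeq M C A (m + 1) ^ 2
        = C ^ 2 * A ^ (2 * m + 2) * M (m + 3) := by
          rw [carlemanSeq, mul_pow, Real.sq_sqrt h1.le]; ring
      _ ≤ C ^ 2 * A ^ (2 * m + 2) * (Real.sqrt (M (m + 2)) * Real.sqrt (M (m + 4))) := by gcongr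
      _ = _ := by simp only [carlemanSeq]; ring
  diverges := by
    have h1 := hM.diverges
    rw [← summable_nat_add_iff 2, ← summable_mul_left_iff (inv_ne_zero hA.ne')] at h1
    refine fun h => h1 (h.congr fun m => ?_)
    have := hM.pos (m + 3)
    have : Real.sqrt (M (m + 3)) ≠ 0 := by positivity
    rw [Real.sqrt_div' _ (hM.pos _).le]
    simp only [carlemanSeq, add_right_comm m 2 1]
    field_simp
    ring

lemma carlemanSeq_add_le {M : ℕ → ℝ} {C C' A A' : ℝ} (hC : 0 ≤ C) (hC' : 0 ≤ C') (hA : 0 ≤ A)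
    (hA' : 0 ≤ A') (m : ℕ) : carlemanSeq M C A m + carlemanSeq M C' A' m ≤
      carlemanSeq M (C + C') (max A A') m := by
  have h1 : A ^ m ≤ max A A' ^ m := pow_le_pow_left₀ hA (le_max_left _ _) m
  have h2 : A' ^ m ≤ max A A' ^ m := pow_le_pow_left₀ hA' (le_max_right _ _) m
  simp only [carlemanSeq]
  rw [← add_mul, add_mul C]
  gcongr

/-- The derivative of order `m` of the term of index `k` of a trigonometric series. -/
def trigTerm (a b : ℕ → ℝ) (m k : ℕ) (x : ℝ) : ℝ :=
  (k : ℝ) ^ m * (a k * Real.cos (k * x + m * (Real.pi / 2)) +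
    b k * Real.sin (k * x + m * (Real.pi / 2)))

lemma hasDerivAt_trigTerm (a b : ℕ → ℝ) (m k : ℕ) (x : ℝ) :
    HasDerivAt (trigTerm a b m k) (trigTerm a b (m + 1) k x) x := by
  have h1 : HasDerivAt (fun x : ℝ => k * x + m * (Real.pi / 2)) k x := by
    simpa using ((hasDerivAt_id x).const_mul (k : ℝ)).add_const (m * (Real.pi / 2))
  refine (((h1.cos.const_mul (a k)).add (h1.sin.const_mul (b k))).const_mul
    ((k : ℝ) ^ m)).congr_deriv ?_
  have h2 : (k : ℝ) * x + (m + 1 : ℕ) * (Real.pi / 2) =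
      k * x + m * (Real.pi / 2) + Real.pi / 2 := by push_cast; ring
  rw [trigTerm, h2, Real.cos_add_pi_div_two, Real.sin_add_pi_div_two]
  ring

lemma abs_trigTerm_le (a b : ℕ → ℝ) (m k : ℕ) (x : ℝ) :
    |trigTerm a b m k x| ≤ (k : ℝ) ^ m * |a k| + (k : ℝ) ^ m * |b k| := by
  rw [trigTerm, abs_mul, abs_of_nonneg (by positivity : (0 : ℝ) ≤ (k : ℝ) ^ m), ← mul_add]
  refine mul_le_mul_of_nonneg_left ((abs_add_le _ _).trans (add_le_add ?_ ?_)) (by positivity)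
  · rw [abs_mul]; exact mul_le_of_le_one_right (abs_nonneg _) (Real.abs_cos_le_one _)
  · rw [abs_mul]; exact mul_le_of_le_one_right (abs_nonneg _) (Real.abs_sin_le_one _)

lemma SeqClassBound.pow_mul_abs_le {M : ℕ → ℝ} {ρ : ℝ} {a : ℕ → ℝ} (ha : SeqClassBound M ρ a)
    (hρ : 0 ≤ ρ) (m k : ℕ) : ((k + 1 : ℕ) : ℝ) ^ m * |a (k + 1)| ≤
      carlemanSeq M ρ (Real.sqrt ρ) m * (((k + 1 : ℕ) : ℝ) ^ 2)⁻¹ := by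
  obtain ⟨h1, h2⟩ := ha (m + 2)
  have h3 : ((k + 1 : ℕ) : ℝ) ^ (2 * (m + 2)) * |a (k + 1)| ^ 2 ≤ M (m + 2) * ρ ^ (m + 2) :=
    (h1.le_tsum k fun j _ => by positivity).trans h2
  have h4 : (((k + 1 : ℕ) : ℝ) ^ (m + 2) * |a (k + 1)|) ≤
      Real.sqrt (ρ ^ (m + 2) * M (m + 2)) :=
    Real.le_sqrt_of_sq_le (le_trans (le_of_eq (by ring)) (h3.trans_eq (by ring)))
  have h5 : Real.sqrt (ρ ^ (m + 2)) = ρ * Real.sqrt ρ ^ m := by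
    have h6 : ρ * Real.sqrt ρ ^ m * (ρ * Real.sqrt ρ ^ m) = ρ ^ (m + 2) := by
      calc _ = ρ ^ 2 * (Real.sqrt ρ * Real.sqrt ρ) ^ m := by rw [mul_pow]; ring
        _ = _ := by rw [Real.mul_self_sqrt hρ]; ring
    rw [← h6, Real.sqrt_mul_self (by positivity)]
  rw [Real.sqrt_mul (by positivity), h5] at h4
  rw [← div_eq_mul_inv, le_div_iff₀ (by positivity)]
  exact le_trans (le_of_eq (by ring)) h4

/-- The functions of a quasianalytic class of trigonometric series have bounds for derivatives that
depend only on the class and on a bound for the function itself (the class does not control the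
constant term of the series). -/
theorem FunClassBound.derivBound {M : ℕ → ℝ} {ρ : ℝ} {g : ℝ → ℝ} (hM : ∀ m, 0 < M m)
    (hρ : 0 < ρ) (hg : FunClassBound M ρ g) {D : ℝ} (hD : ∀ x, |g x| ≤ D) :
    DerivBound (carlemanSeq M (D / Real.sqrt (M 2) +
      2 * (ρ * ∑' k : ℕ, (((k + 1 : ℕ) : ℝ) ^ 2)⁻¹)) (Real.sqrt ρ)) g := by
  obtain ⟨a, b, hlim, ha, hb⟩ := hg
  set S := ∑' k : ℕ, (((k + 1 : ℕ) : ℝ) ^ 2)⁻¹ with hS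
  have hSsum : Summable fun k : ℕ => (((k + 1 : ℕ) : ℝ) ^ 2)⁻¹ :=
    (summable_nat_add_iff 1).mpr (Real.summable_nat_pow_inv.mpr one_lt_two)
  have hS0 : 0 ≤ S := tsum_nonneg fun k => by positivity
  have hD0 : 0 ≤ D := (abs_nonneg _).trans (hD 0)
  let u : ℕ → ℕ → ℝ := fun m k => (k : ℝ) ^ m * |a k| + (k : ℝ) ^ m * |b k|
  have hu1 (m k : ℕ) : u m (k + 1) ≤
      2 * carlemanSeq M ρ (Real.sqrt ρ) m * (((k + 1 : ℕ) : ℝ) ^ 2)⁻¹ := by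
    have := ha.pow_mul_abs_le hρ.le m k
    have := hb.pow_mul_abs_le hρ.le m k
    simp only [u]
    linarith
  have husum1 (m : ℕ) : Summable fun k => u m (k + 1) :=
    Summable.of_nonneg_of_le (fun k => by positivity) (hu1 m) (hSsum.mul_left _)
  have husum (m : ℕ) : Summable (u m) := (summable_nat_add_iff 1).mp (husum1 m)
  have hsum (m : ℕ) (x : ℝ) : Summable fun k => trigTerm a b m k x :=
    Summable.of_norm_bounded (husum m) fun k => abs_trigTerm_le a b m k x
  have hg0 (x : ℝ) : ∑' k, trigTerm a b 0 k x = g x := by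
    refine tendsto_nhds_unique
      ((hsum 0 x).hasSum.tendsto_sum_nat.comp (tendsto_add_atTop_nat 1)) ?_
    simpa [Function.comp_def, trigTerm] using hlim.tendsto_at x
  refine ⟨fun m x => ∑' k, trigTerm a b m k x, funext hg0, fun m x => ?_, fun m x => ?_⟩
  · exact hasDerivAt_tsum (husum (m + 1)) (fun k y => hasDerivAt_trigTerm a b m k y)
      (fun k y => abs_trigTerm_le a b (m + 1) k y) (hsum m x) x
  · have h2 := hM 2
    have hmM := hM (m + 2)
    rcases Nat.eq_zero_or_pos m with rfl | hm
    · simp only [hg0]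
      have hsq : Real.sqrt (M 2) ≠ 0 := by positivity
      calc |g x| ≤ D := hD x
        _ = D / Real.sqrt (M 2) * Real.sqrt (M 2) := by field_simp
        _ ≤ (D / Real.sqrt (M 2) + 2 * (ρ * S)) * Real.sqrt (M 2) := by
          gcongr
          have : 0 ≤ 2 * (ρ * S) := by positivity
          linarith
        _ = _ := by simp [carlemanSeq]
    · have hu0 : u m 0 = 0 := by simp [u, hm.ne']
      calc |∑' k, trigTerm a b m k x| ≤ ∑' k, u m k :=
            tsum_of_norm_bounded (f := fun k => trigTerm a b m k x) (husum m).hasSum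
              fun k => abs_trigTerm_le a b m k x
        _ = ∑' k, u m (k + 1) := by rw [(husum m).tsum_eq_zero_add, hu0, zero_add]
        _ ≤ ∑' k : ℕ, 2 * carlemanSeq M ρ (Real.sqrt ρ) m * (((k + 1 : ℕ) : ℝ) ^ 2)⁻¹ :=
            (husum1 m).tsum_le_tsum (hu1 m) (hSsum.mul_left _)
        _ = carlemanSeq M (2 * (ρ * S)) (Real.sqrt ρ) m := by
            rw [tsum_mul_left, ← hS]; simp only [carlemanSeq]; ring
        _ ≤ _ := by
            simp only [carlemanSeq]
            gcongr
            have : 0 ≤ D / Real.sqrt (M 2) := by positivity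
            linarith

/-! ### Chords of the unit disk -/

lemma polarPoint_apply_zero (r θ : ℝ) : polarPoint r θ 0 = r * Real.cos θ := rfl

lemma polarPoint_apply_one (r θ : ℝ) : polarPoint r θ 1 = r * Real.sin θ := rfl

lemma space_two_ext {x y : Space 2} (h0 : x 0 = y 0) (h1 : x 1 = y 1) : x = y := by
  ext i
  fin_cases i
  · exact h0
  · exact h1

lemma norm_sq_space_two (x : Space 2) : ‖x‖ ^ 2 = x 0 ^ 2 + x 1 ^ 2 := by
  rw [EuclideanSpace.real_norm_sq_eq, Fin.sum_univ_two]

lemma norm_polarPoint (r θ : ℝ) : ‖polarPoint r θ‖ = |r| := by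
  rw [← sq_eq_sq₀ (norm_nonneg _) (abs_nonneg _), norm_sq_space_two, sq_abs,
    polarPoint_apply_zero, polarPoint_apply_one]
  linear_combination r ^ 2 * Real.sin_sq_add_cos_sq θ

lemma exists_eq_polarPoint (x : Space 2) : ∃ θ, x = polarPoint ‖x‖ θ := by
  refine ⟨Complex.arg ⟨x 0, x 1⟩, ?_⟩
  have hn : ‖x‖ = ‖(⟨x 0, x 1⟩ : ℂ)‖ := by
    rw [← sq_eq_sq₀ (norm_nonneg _) (norm_nonneg _), norm_sq_space_two, Complex.sq_norm,
      Complex.normSq_mk]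
    ring
  refine space_two_ext ?_ ?_
  · rw [polarPoint_apply_zero, hn, Complex.norm_mul_cos_arg]
  · rw [polarPoint_apply_one, hn, Complex.norm_mul_sin_arg]

lemma polarPoint_add_int_mul_two_pi (r θ : ℝ) (k : ℤ) :
    polarPoint r (θ + k * (2 * Real.pi)) = polarPoint r θ := by
  simp only [polarPoint, Real.cos_add_int_mul_two_pi, Real.sin_add_int_mul_two_pi]

lemma continuous_polarPoint (r : ℝ) : Continuous (polarPoint r) := by
  unfold polarPoint
  fun_prop

/-- The point dividing the chord from angle `φ` to angle `φ + β` in the ratio `t : 1 - t`. -/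
def chordPoint (β φ t : ℝ) : Space 2 :=
  (1 - t) • polarPoint 1 φ + t • polarPoint 1 (φ + β)

lemma continuous_chordPoint (β φ : ℝ) : Continuous (chordPoint β φ) := by
  unfold chordPoint
  fun_prop

lemma chordPoint_mem_closedBall (β φ : ℝ) {t : ℝ} (ht : t ∈ unitInterval) :
    chordPoint β φ t ∈ Metric.closedBall (0 : Space 2) 1 := by
  refine (convex_closedBall (0 : Space 2) 1) ?_ ?_ (sub_nonneg.mpr ht.2) ht.1 (by ring) <;>
    simp [norm_polarPoint]

/-- A point of a chord of the unit circle in polar coordinates: turning the chord only turns the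
point, and the point is not closer to the origin than the middle of the chord. -/
lemma exists_chordPoint_eq_polarPoint (β : ℝ) {t : ℝ} (ht : t ∈ unitInterval) :
    ∃ r ψ : ℝ, Real.sqrt ((1 + Real.cos β) / 2) ≤ r ∧ r ≤ 1 ∧
      ∀ φ, chordPoint β φ t = polarPoint r (φ + ψ) := by
  obtain ⟨ψ, hψ⟩ := exists_eq_polarPoint (chordPoint β 0 t)
  have h0 : ‖chordPoint β 0 t‖ * Real.cos ψ = 1 - t + t * Real.cos β := by
    have := congrArg (fun x : Space 2 => x 0) hψ
    simpa [chordPoint, polarPoint, eq_comm] using this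
  have h1 : ‖chordPoint β 0 t‖ * Real.sin ψ = t * Real.sin β := by
    have := congrArg (fun x : Space 2 => x 1) hψ
    simpa [chordPoint, polarPoint, eq_comm] using this
  refine ⟨‖chordPoint β 0 t‖, ψ, ?_, ?_, fun φ => ?_⟩
  · refine Real.sqrt_le_iff.mpr ⟨norm_nonneg _, ?_⟩
    have h2 : ‖chordPoint β 0 t‖ ^ 2 = 1 - 2 * (t * (1 - t)) * (1 - Real.cos β) := by
      linear_combination (-‖chordPoint β 0 t‖ ^ 2) * Real.sin_sq_add_cos_sq ψ +
        (‖chordPoint β 0 t‖ * Real.cos ψ + (1 - t + t * Real.cos β)) * h0 +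
        (‖chordPoint β 0 t‖ * Real.sin ψ + t * Real.sin β) * h1 +
        t ^ 2 * Real.sin_sq_add_cos_sq β
    rw [h2]
    nlinarith [mul_nonneg (sq_nonneg (1 - 2 * t)) (sub_nonneg.mpr (Real.cos_le_one β))]
  · simpa using chordPoint_mem_closedBall β 0 ht
  · generalize ‖chordPoint β 0 t‖ = r at h0 h1 ⊢
    refine space_two_ext ?_ ?_
    · simp only [chordPoint, PiLp.add_apply, PiLp.smul_apply, smul_eq_mul, polarPoint_apply_zero,
        Real.cos_add]
      linear_combination (-Real.cos φ) * h0 + Real.sin φ * h1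
    · simp only [chordPoint, PiLp.add_apply, PiLp.smul_apply, smul_eq_mul, polarPoint_apply_one,
        Real.sin_add]
      linear_combination (-Real.sin φ) * h0 - Real.cos φ * h1

/-- The average of `h` over the chord from angle `φ` to angle `φ + β`. -/
def chordAverage (h : Space 2 → ℝ) (β φ : ℝ) : ℝ :=
  ∫ t : unitInterval, h (chordPoint β φ t)

lemma chordAverage_add_two_pi (h : Space 2 → ℝ) (β φ : ℝ) :
    chordAverage h β (φ + 2 * Real.pi) = chordAverage h β φ := by
  have h1 (θ : ℝ) : polarPoint 1 (θ + 2 * Real.pi) = polarPoint 1 θ := by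
    simpa using polarPoint_add_int_mul_two_pi 1 θ 1
  simp only [chordAverage, chordPoint, add_right_comm φ (2 * Real.pi), h1]

lemma continuous_comp_chordPoint {h : Space 2 → ℝ}
    (hh : ContinuousOn h (Metric.closedBall 0 1)) (β φ : ℝ) :
    Continuous fun t : unitInterval => h (chordPoint β φ t) :=
  hh.comp_continuous ((continuous_chordPoint β φ).comp continuous_subtype_val)
    fun t => chordPoint_mem_closedBall β φ t.2

/-- On each annulus `R ≤ r ≤ 1` the angular derivatives of `h` satisfy, uniformly in `r`, the bounds
of a quasianalytic class. -/
def HasQuasianalyticAngularBounds (h : Space 2 → ℝ) : Prop :=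
  ∀ R : ℝ, 0 < R → R ≤ 1 → ∃ B : ℕ → ℝ, IsDenjoyCarlemanSeq B ∧
    ∀ r : ℝ, R ≤ r → r ≤ 1 → DerivBound B fun θ => h (polarPoint r θ)

lemma IsDenjoyCarlemanSeq.const_mul {B : ℕ → ℝ} (hB : IsDenjoyCarlemanSeq B) {c : ℝ}
    (hc : 0 < c) : IsDenjoyCarlemanSeq fun m => c * B m where
  pos m := mul_pos hc (hB.pos m)
  logConvex m := by nlinarith [hB.logConvex m, sq_nonneg c]
  diverges := by simpa only [mul_div_mul_left _ _ hc.ne'] using hB.diverges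

lemma cos_ne_neg_one_of_irrational {β : ℝ} (hβ : Irrational (β / (2 * Real.pi))) :
    Real.cos β ≠ -1 := by
  intro h
  obtain ⟨k, hk⟩ := Real.cos_eq_neg_one_iff.mp h
  refine hβ ⟨1 / 2 + k, ?_⟩
  have := Real.pi_pos
  rw [← hk]
  push_cast
  field_simp

/-- The average over a chord that misses the centre, as a function of the position of the chord,
belongs to a quasianalytic class. -/
lemma exists_derivBound_chordAverage {h : Space 2 → ℝ}
    (hh : ContinuousOn h (Metric.closedBall 0 1)) (hB : HasQuasianalyticAngularBounds h) {β : ℝ}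
    (hβ : Real.cos β ≠ -1) :
    ∃ B, IsDenjoyCarlemanSeq B ∧ DerivBound B (chordAverage h β) := by
  have hcos : 0 < (1 + Real.cos β) / 2 := by
    have := lt_of_le_of_ne (Real.neg_one_le_cos β) hβ.symm
    linarith
  obtain ⟨B, hBseq, hB⟩ := hB (Real.sqrt ((1 + Real.cos β) / 2)) (Real.sqrt_pos.mpr hcos)
    (Real.sqrt_le_one.mpr (by linarith [Real.cos_le_one β]))
  refine ⟨B, hBseq, ?_⟩
  refine DerivBound.integral (F := fun (t : unitInterval) φ => h (chordPoint β φ t))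
    (fun t => ?_) fun φ => (continuous_comp_chordPoint hh β φ).measurable
  obtain ⟨r, ψ, hr, hr1, heq⟩ := exists_chordPoint_eq_polarPoint β t.2
  simp only [heq]
  simpa using (hB r hr hr1).comp_affine (σ := 1) (by simp) ψ

/-! ### Chords of irrational angle -/

/-- A continuous function on the circle whose sums over `N` steps of an irrational rotation vanish
is zero: it is invariant under the `N`-th power of the rotation, hence constant. -/
lemma eq_zero_of_sum_rotation_eq_zero {I : ℝ → ℝ} (hI : Continuous I)
    (hper : ∀ φ, I (φ + 2 * Real.pi) = I φ) {β : ℝ} (hβ : Irrational (β / (2 * Real.pi)))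
    {N : ℕ} (hN : 0 < N) (hsum : ∀ φ, ∑ k ∈ Finset.range N, I (φ + k * β) = 0) (φ : ℝ) :
    I φ = 0 := by
  have hperN (φ : ℝ) : I (φ + N * β) = I φ := by
    have h1 := hsum (φ + β)
    have h2 := Finset.sum_range_succ' (fun k : ℕ => I (φ + k * β)) N
    rw [Finset.sum_range_succ, hsum φ] at h2
    have h3 : ∑ k ∈ Finset.range N, I (φ + (k + 1 : ℕ) * β) = 0 := by
      rw [← h1]
      refine Finset.sum_congr rfl fun k _ => ?_
      congr 1; push_cast; ring
    rw [h3] at h2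
    simpa using h2
  let P : AddSubgroup ℝ :=
    { carrier := {p | ∀ φ, I (φ + p) = I φ}
      zero_mem' := fun φ => by simp
      add_mem' := fun {p q} hp hq φ => by rw [← add_assoc, hq, hp]
      neg_mem' := fun {p} hp φ => by rw [← hp (φ + -p)]; simp }
  have hPclosed : IsClosed (P : Set ℝ) := by
    have : (P : Set ℝ) = ⋂ φ, {p | I (φ + p) = I φ} := by ext; simp [P]
    rw [this]
    exact isClosed_iInter fun φ => isClosed_eq (by fun_prop) continuous_const
  have hdense : Dense (P : Set ℝ) := by
    have hirr : Irrational (N * β / (2 * Real.pi)) := by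
      rw [mul_div_assoc]
      exact hβ.natCast_mul hN.ne'
    refine (dense_addSubgroupClosure_pair_iff.mpr hirr).mono ?_
    refine (AddSubgroup.closure_le P).mpr ?_
    rintro p (rfl | rfl)
    · exact hperN
    · exact hper
  have hP (p : ℝ) : p ∈ P := by
    have := hPclosed.closure_eq ▸ hdense p
    exact this
  have h4 := hsum φ
  simp only [fun k : ℕ => hP (k * β) φ, Finset.sum_const, Finset.card_range, nsmul_eq_mul,
    mul_eq_zero, Nat.cast_eq_zero] at h4
  exact h4.resolve_left hN.ne'

/-- If the sums of the averages over consecutive chords of irrational angle `β` vanish whenever the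
two ends of the polygonal path have their angles in the open set `U`, then the averages over all
chords of angle `β` vanish: by recurrence of the rotation the number of chords can be chosen so that
the hypothesis holds for an open set of initial points, and the sum is quasianalytic. -/
theorem chordAverage_eq_zero {h : Space 2 → ℝ}
    (hh : ContinuousOn h (Metric.closedBall 0 1)) (hB : HasQuasianalyticAngularBounds h)
    {U : Set ℝ} (hU : IsOpen U) (hne : U.Nonempty)
    (hper : ∀ θ ∈ U, ∀ k : ℤ, θ + k * (2 * Real.pi) ∈ U) {β : ℝ}
    (hβ : Irrational (β / (2 * Real.pi)))
    (hray : ∀ (N : ℕ) (θ : ℝ), 0 < N → θ ∈ U → θ + N * β ∈ U →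
      ∑ k ∈ Finset.range N, chordAverage h β (θ + k * β) = 0) (φ : ℝ) :
    chordAverage h β φ = 0 := by
  obtain ⟨B, hBseq, hBI⟩ := exists_derivBound_chordAverage hh hB (cos_ne_neg_one_of_irrational hβ)
  obtain ⟨θ₀, hθ₀⟩ := hne
  obtain ⟨ε, hε, hball⟩ := Metric.isOpen_iff.mp hU θ₀ hθ₀
  have hpi := Real.pi_pos
  obtain ⟨n, hn⟩ := exists_nat_one_div_lt (show 0 < ε / 2 / (2 * Real.pi) by positivity)
  obtain ⟨N, hN, -, hNβ⟩ := Real.exists_nat_abs_mul_sub_round_le (β / (2 * Real.pi))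
    (Nat.succ_pos n)
  set j := round ((N : ℝ) * (β / (2 * Real.pi))) with hj
  have hδ : |N * β - j * (2 * Real.pi)| < ε / 2 := by
    have h1 : N * β - j * (2 * Real.pi) =
        (N * (β / (2 * Real.pi)) - j) * (2 * Real.pi) := by field_simp
    rw [h1, abs_mul, abs_of_pos (by positivity : 0 < 2 * Real.pi), ← lt_div_iff₀ (by positivity)]
    refine lt_of_le_of_lt (hNβ.trans ?_) hn
    refine one_div_le_one_div_of_le (by positivity) ?_
    push_cast
    linarith
  have hS : DerivBound (fun m => N * B m)
      fun φ => ∑ k ∈ Finset.range N, chordAverage h β (φ + k * β) := by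
    have := DerivBound.sum (Finset.range N) (B := B)
      (g := fun (k : ℕ) φ => chordAverage h β (φ + k * β))
      fun k _ => by simpa using hBI.comp_affine (σ := 1) (by simp) (k * β)
    simpa using this
  refine eq_zero_of_sum_rotation_eq_zero hBI.continuous (chordAverage_add_two_pi h β) hβ hN
    (fun φ => hS.eq_zero (hBseq.const_mul (Nat.cast_pos.mpr hN)) (x := θ₀) ?_ φ) φ
  filter_upwards [Metric.ball_mem_nhds θ₀ (half_pos hε)] with θ hθ
  rw [Metric.mem_ball, Real.dist_eq] at hθ
  refine hray N θ hN (hball ?_) ?_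
  · rw [Metric.mem_ball, Real.dist_eq]; linarith
  · have h2 := hper (θ + (N * β - j * (2 * Real.pi))) (hball ?_) j
    · convert h2 using 1; ring
    · rw [Metric.mem_ball, Real.dist_eq]
      calc |θ + (N * β - j * (2 * Real.pi)) - θ₀|
          = |(θ - θ₀) + (N * β - j * (2 * Real.pi))| := by ring_nf
        _ ≤ |θ - θ₀| + |N * β - j * (2 * Real.pi)| := abs_add_le _ _
        _ < ε := by linarith

/-! ### Injectivity of the X-ray transform -/

lemma chordAverage_eq_intervalIntegral (h : Space 2 → ℝ) (β φ : ℝ) :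
    chordAverage h β φ = ∫ t in (0 : ℝ)..1, h (chordPoint β φ t) := by
  rw [chordAverage, intervalIntegral.integral_of_le zero_le_one, ← integral_Icc_eq_integral_Ioc]
  exact integral_subtype measurableSet_Icc fun t => h (chordPoint β φ t)

/-- The point of the line with unit normal at angle `α` and signed distance `s` from the origin. -/
def linePoint (α s t : ℝ) : Space 2 :=
  s • polarPoint 1 α + t • polarPoint 1 (α + Real.pi / 2)

lemma norm_sq_linePoint (α s t : ℝ) : ‖linePoint α s t‖ ^ 2 = s ^ 2 + t ^ 2 := by
  rw [norm_sq_space_two]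
  simp only [linePoint, PiLp.add_apply, PiLp.smul_apply, smul_eq_mul, polarPoint_apply_zero,
    polarPoint_apply_one, Real.cos_add_pi_div_two, Real.sin_add_pi_div_two]
  linear_combination (s ^ 2 + t ^ 2) * Real.sin_sq_add_cos_sq α

lemma inner_linePoint (α s t r : ℝ) : inner ℝ (linePoint α s t) (polarPoint r α) = s * r := by
  rw [PiLp.inner_apply, Fin.sum_univ_two]
  simp only [linePoint, PiLp.add_apply, PiLp.smul_apply, smul_eq_mul, polarPoint_apply_zero,
    polarPoint_apply_one, Real.cos_add_pi_div_two, Real.sin_add_pi_div_two, RCLike.inner_apply,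
    conj_trivial]
  linear_combination s * r * Real.sin_sq_add_cos_sq α

/-- The coordinates along a line and perpendicular to it preserve the area. -/
lemma measurePreserving_linePoint (α : ℝ) :
    MeasurePreserving fun p : ℝ × ℝ => linePoint α p.1 p.2 := by
  have horth : Orthonormal ℝ ![polarPoint 1 α, polarPoint 1 (α + Real.pi / 2)] := by
    have h0 (θ : ℝ) : ‖polarPoint 1 θ‖ = 1 := by simp [norm_polarPoint]
    have h1 : inner ℝ (polarPoint 1 α) (polarPoint 1 (α + Real.pi / 2)) = (0 : ℝ) := by
      have := inner_linePoint α 0 1 1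
      rw [real_inner_comm]
      simpa [linePoint] using this
    refine ⟨fun i => ?_, fun i j hij => ?_⟩
    · fin_cases i <;> simp [h0]
    · fin_cases i <;> fin_cases j <;> simp_all [real_inner_comm]
  obtain ⟨b, hb⟩ := Orthonormal.exists_orthonormalBasis_extension_of_card_eq
    (𝕜 := ℝ) (E := Space 2) (by simp) (s := Set.univ)
    (horth.comp _ Subtype.val_injective)
  have h1 := b.measurePreserving_repr_symm.comp ((PiLp.volume_preserving_toLp (Fin 2)).comp
    (volume_preserving_finTwoArrow ℝ).symm)
  have h2 : (fun p : ℝ × ℝ => linePoint α p.1 p.2) = b.repr.symm ∘ (WithLp.toLp 2 ∘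
      (MeasurableEquiv.finTwoArrow (α := ℝ)).symm) := by
    ext1 p
    have hsum := b.sum_repr_symm (WithLp.toLp 2 ![p.1, p.2])
    simp only [Fin.sum_univ_two, hb 0 trivial, hb 1 trivial] at hsum
    exact hsum
  exact h2 ▸ h1

/-- Up to the factor `2 sin (β / 2)`, the integral of `h` along a line that meets the disk is the
average over the chord that the line cuts out of the disk. -/
lemma integral_linePoint_eq_zero {h : Space 2 → ℝ}
    (hzero : ∀ β : ℝ, Irrational (β / (2 * Real.pi)) → ∀ φ, chordAverage h β φ = 0) (α s : ℝ)
    (hs : Irrational (Real.arccos s / Real.pi)) :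
    ∫ t, (Metric.closedBall (0 : Space 2) 1).indicator h (linePoint α s t) = 0 := by
  have hpi := Real.pi_pos
  set γ := Real.arccos s with hγ
  have hγ0 : γ ≠ 0 := fun h => hs ⟨0, by simp [h]⟩
  have hγpi : γ ≠ Real.pi := fun h => hs ⟨1, by rw [h, div_self hpi.ne']; simp⟩
  have hs1 : s < 1 := by
    by_contra hle
    exact hγ0 (Real.arccos_eq_zero.mpr (not_lt.mp hle))
  have hs2 : -1 < s := by
    by_contra hle
    exact hγpi (Real.arccos_eq_pi.mpr (not_lt.mp hle))
  have hcos : Real.cos γ = s := Real.cos_arccos hs2.le hs1.le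
  set σ := Real.sin γ with hσ
  have hσ0 : 0 < σ := Real.sin_pos_of_pos_of_lt_pi
    ((Real.arccos_nonneg s).lt_of_ne' hγ0) ((Real.arccos_le_pi s).lt_of_ne hγpi)
  have hsσ : s ^ 2 + σ ^ 2 = 1 := by rw [← hcos, hσ]; exact Real.cos_sq_add_sin_sq γ
  have hind (t : ℝ) : (Metric.closedBall (0 : Space 2) 1).indicator h (linePoint α s t) =
      (Set.Icc (-σ) σ).indicator (fun t => h (linePoint α s t)) t := by
    have hiff : linePoint α s t ∈ Metric.closedBall (0 : Space 2) 1 ↔ t ∈ Set.Icc (-σ) σ := by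
      rw [mem_closedBall_zero_iff, ← sq_le_one_iff₀ (norm_nonneg _), norm_sq_linePoint, Set.mem_Icc,
        ← abs_le, ← abs_of_pos hσ0, ← sq_le_sq]
      constructor <;> intro h <;> linarith
    by_cases ht : t ∈ Set.Icc (-σ) σ
    · rw [Set.indicator_of_mem (hiff.mpr ht), Set.indicator_of_mem ht]
    · rw [Set.indicator_of_notMem (mt hiff.mp ht), Set.indicator_of_notMem ht]
  have hchord (τ : ℝ) : chordPoint (2 * γ) (α - γ) τ = linePoint α s (2 * σ * τ + -σ) := by
    have h1 : α - γ + 2 * γ = α + γ := by ring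
    refine space_two_ext ?_ ?_ <;>
    · simp only [chordPoint, linePoint, h1, PiLp.add_apply, PiLp.smul_apply, smul_eq_mul,
        polarPoint_apply_zero, polarPoint_apply_one, Real.cos_add_pi_div_two,
        Real.sin_add_pi_div_two]
      simp only [Real.cos_add, Real.sin_add, Real.cos_sub, Real.sin_sub, hcos, ← hσ]
      ring
  have h2γ : 2 * γ / (2 * Real.pi) = γ / Real.pi := mul_div_mul_left _ _ two_ne_zero
  have h0 := hzero (2 * γ) (h2γ ▸ hs) (α - γ)
  simp only [chordAverage_eq_intervalIntegral, hchord] at h0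
  have h1 := intervalIntegral.smul_integral_comp_mul_add (a := 0) (b := 1)
    (fun t => h (linePoint α s t)) (2 * σ) (-σ)
  rw [h0, smul_zero, mul_zero, zero_add, mul_one, show 2 * σ + -σ = σ by ring,
    intervalIntegral.integral_of_le (by linarith), ← integral_Icc_eq_integral_Ioc] at h1
  simp only [hind]
  rw [integral_indicator measurableSet_Icc, ← h1]

lemma ae_irrational_arccos_div_pi : ∀ᵐ s : ℝ, s ∈ Set.Ioo (-1) 1 →
    Irrational (Real.arccos s / Real.pi) := by
  have hcount : (Set.range fun q : ℚ => Real.cos (q * Real.pi)).Countable :=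
    Set.countable_range _
  filter_upwards [hcount.ae_notMem volume] with s hs hs1
  rintro ⟨q, hq⟩
  refine hs ⟨q, ?_⟩
  have := Real.pi_pos.ne'
  simp only [hq]
  rw [div_mul_cancel₀ _ this, Real.cos_arccos hs1.1.le hs1.2.le]

/-- A continuous function on the closed disk is zero if its averages over almost all chords vanish:
the Fourier transform of its extension by zero, being the one-dimensional Fourier transform of its
integrals over parallel lines, vanishes. -/
theorem eq_zero_of_chordAverage_eq_zero {h : Space 2 → ℝ}
    (hh : ContinuousOn h (Metric.closedBall 0 1))
    (hzero : ∀ β : ℝ, Irrational (β / (2 * Real.pi)) → ∀ φ, chordAverage h β φ = 0) :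
    ∀ x ∈ Metric.closedBall (0 : Space 2) 1, h x = 0 := by
  set D := Metric.closedBall (0 : Space 2) 1 with hD
  have hint : Integrable (D.indicator h) :=
    (integrable_indicator_iff Metric.isClosed_closedBall.measurableSet).mpr
      (hh.integrableOn_compact (isCompact_closedBall 0 1))
  set H : Space 2 → ℂ := fun x => ((D.indicator h x : ℝ) : ℂ) with hH
  have hHint : Integrable H := hint.ofReal
  have hline (α : ℝ) : ∀ᵐ s : ℝ, ∫ t, D.indicator h (linePoint α s t) = 0 := by
    have hend : ∀ᵐ s : ℝ, s ∉ ({-1, 1} : Set ℝ) :=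
      (Set.toFinite _).countable.ae_notMem volume
    filter_upwards [ae_irrational_arccos_div_pi, hend] with s hs hs'
    by_cases hs1 : s ∈ Set.Ioo (-1) 1
    · exact integral_linePoint_eq_zero hzero α s (hs hs1)
    · -- The line misses the disk.
      refine integral_eq_zero_of_ae (Eventually.of_forall fun t => ?_)
      refine Set.indicator_of_notMem (fun hmem => hs1 ?_) _
      rw [hD, mem_closedBall_zero_iff, ← sq_le_one_iff₀ (norm_nonneg _), norm_sq_linePoint] at hmem
      have h1 := abs_le.mp ((sq_le_one_iff_abs_le_one s).mp (by nlinarith [sq_nonneg t]))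
      simp only [Set.mem_insert_iff, Set.mem_singleton_iff, not_or] at hs'
      exact ⟨h1.1.lt_of_ne' hs'.1, h1.2.lt_of_ne hs'.2⟩
  have hfourier : 𝓕 H = 0 := by
    ext1 ξ
    obtain ⟨α, hα⟩ := exists_eq_polarPoint ξ
    have hmp := measurePreserving_linePoint α
    rw [Real.fourier_eq, hα, Pi.zero_apply]
    have hgint : Integrable fun v => 𝐞 (-(inner ℝ v (polarPoint ‖ξ‖ α))) • H v :=
      (Real.fourierIntegral_convergent_iff (μ := volume) (polarPoint ‖ξ‖ α)).mpr hHint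
    have h1 := integral_map hmp.measurable.aemeasurable
      (hmp.map_eq.symm ▸ hgint.aestronglyMeasurable)
    rw [hmp.map_eq] at h1
    rw [h1]
    refine (integral_prod _ (hmp.integrable_comp_of_integrable hgint)).trans ?_
    refine integral_eq_zero_of_ae ?_
    filter_upwards [hline α] with s hs
    simp only [Function.comp_apply, inner_linePoint, hH, Pi.zero_apply, Circle.smul_def]
    have h2 : ∫ t, ((D.indicator h (linePoint α s t) : ℝ) : ℂ) = 0 := by
      rw [integral_complex_ofReal, hs, Complex.ofReal_zero]
    rw [integral_smul, h2, smul_zero]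
  have hball : Set.EqOn h 0 (Metric.ball 0 1) := by
    intro x hx
    have hnhds : D ∈ 𝓝 x := mem_of_superset (Metric.isOpen_ball.mem_nhds hx)
      Metric.ball_subset_closedBall
    have hcont : ContinuousAt H x := by
      refine Complex.continuous_ofReal.continuousAt.comp ?_
      refine (hh.continuousAt hnhds).congr ?_
      filter_upwards [hnhds] with y hy
      exact (Set.indicator_of_mem hy h).symm
    have h1 := hHint.fourierInv_fourier_eq (by rw [hfourier]; exact integrable_zero _ _ _) hcont
    rw [hfourier, Real.fourierInv_eq] at h1
    simp only [Pi.zero_apply, smul_zero, integral_zero, hH] at h1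
    rw [Set.indicator_of_mem (Metric.ball_subset_closedBall hx)] at h1
    exact_mod_cast h1.symm
  exact hball.of_subset_closure hh continuousOn_const Metric.ball_subset_closedBall
    (closure_ball (0 : Space 2) one_ne_zero).ge

/-! ### Isometries of the plane and restrictions to planes -/

lemma norm_map_polarPoint_one {n : ℕ} (L : Space 2 →ₗᵢ[ℝ] Space n) (θ : ℝ) :
    ‖L (polarPoint 1 θ)‖ = 1 := by
  simp [norm_polarPoint]

/-- In polar coordinates a linear isometry of the plane acts by `θ ↦ ± θ + c`. -/
lemma exists_map_polarPoint_eq (U : Space 2 →ₗᵢ[ℝ] Space 2) :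
    ∃ σ c : ℝ, |σ| = 1 ∧ ∀ r θ, U (polarPoint r θ) = polarPoint r (σ * θ + c) := by
  obtain ⟨c, hc⟩ := exists_eq_polarPoint (U (polarPoint 1 0))
  obtain ⟨d, hd⟩ := exists_eq_polarPoint (U (polarPoint 1 (Real.pi / 2)))
  rw [norm_map_polarPoint_one] at hc hd
  have hinner : Real.cos (d - c) = 0 := by
    have h1 := U.inner_map_map (polarPoint 1 0) (polarPoint 1 (Real.pi / 2))
    rw [hc, hd, PiLp.inner_apply, PiLp.inner_apply, Fin.sum_univ_two, Fin.sum_univ_two] at h1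
    simp only [polarPoint_apply_zero, polarPoint_apply_one, RCLike.inner_apply, conj_trivial] at h1
    simp at h1
    rw [Real.cos_sub]
    linarith
  have hd' : d = c + (d - c) := by ring
  have hcosd : Real.cos d = -(Real.sin (d - c) * Real.sin c) := by
    rw [hd', Real.cos_add, hinner]; ring_nf
  have hsind : Real.sin d = Real.sin (d - c) * Real.cos c := by
    rw [hd', Real.sin_add, hinner]; ring_nf
  have hσ : Real.sin (d - c) = 1 ∨ Real.sin (d - c) = -1 :=
    Real.cos_eq_zero_iff_sin_eq.mp hinner
  have hdecomp (r θ : ℝ) : polarPoint r θ =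
      (r * Real.cos θ) • polarPoint 1 0 + (r * Real.sin θ) • polarPoint 1 (Real.pi / 2) := by
    refine space_two_ext ?_ ?_ <;> simp [polarPoint]
  refine ⟨Real.sin (d - c), c, by rcases hσ with h | h <;> simp [h], fun r θ => ?_⟩
  rw [hdecomp, map_add, map_smul, map_smul, hc, hd]
  refine space_two_ext ?_ ?_
  · simp only [PiLp.add_apply, PiLp.smul_apply, smul_eq_mul, polarPoint_apply_zero, hcosd]
    rcases hσ with h | h <;> simp [h, Real.cos_add] <;> ring
  · simp only [PiLp.add_apply, PiLp.smul_apply, smul_eq_mul, polarPoint_apply_one, hsind]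
    rcases hσ with h | h <;> simp [h, Real.sin_add] <;> ring

/-- Two isometric parametrizations of a plane differ by an isometry of `ℝ²`. -/
lemma exists_linearIsometry_comp_eq {n : ℕ} {L L' : Space 2 →ₗᵢ[ℝ] Space n}
    (h : LinearMap.range L.toLinearMap = LinearMap.range L'.toLinearMap) :
    ∃ U : Space 2 →ₗᵢ[ℝ] Space 2, ∀ x, L' (U x) = L x := by
  let e := LinearEquiv.ofInjective L'.toLinearMap L'.injective
  let u : Space 2 →ₗ[ℝ] Space 2 := e.symm.toLinearMap ∘ₗ
    L.toLinearMap.codRestrict (LinearMap.range L'.toLinearMap) fun x => h ▸ ⟨x, rfl⟩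
  have hu (x : Space 2) : L' (u x) = L x :=
    congrArg Subtype.val (e.apply_symm_apply ⟨L x, h ▸ ⟨x, rfl⟩⟩)
  exact ⟨⟨u, fun x => by rw [← L'.norm_map, hu, L.norm_map]⟩, hu⟩

lemma mapsTo_closedBall_of_linearIsometry (U : Space 2 →ₗᵢ[ℝ] Space 2) :
    Set.MapsTo U (Metric.closedBall 0 1) (Metric.closedBall 0 1) := fun x hx => by
  simpa using hx

lemma UniformlyQuasianalyticDiskIn.exists_derivBound {M : ℝ → ℕ → ℝ} {f : Space 2 → ℝ}
    (hf : UniformlyQuasianalyticDiskIn M f) {R : ℝ} (hR : 0 < R) (hR1 : R ≤ 1) :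
    ∃ C A : ℝ, 0 < C ∧ 0 < A ∧ ∀ r, R ≤ r → r ≤ 1 →
      DerivBound (carlemanSeq (M R) C A) fun θ => f (polarPoint r θ) := by
  obtain ⟨hM, ρ, hρ, hfρ⟩ := hf.2 R hR hR1
  obtain ⟨D, hD⟩ := (isCompact_closedBall (0 : Space 2) 1).exists_bound_of_continuousOn hf.1
  have h2 := hM.pos 2
  refine ⟨_, Real.sqrt ρ, ?_, Real.sqrt_pos.mpr hρ, fun r hr hr1 =>
    (hfρ r hr hr1).derivBound hM.pos hρ (D := |D| + 1) fun θ => ?_⟩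
  · have : (0 : ℝ) ≤ ∑' k : ℕ, (((k + 1 : ℕ) : ℝ) ^ 2)⁻¹ := tsum_nonneg fun k => by positivity
    positivity
  · refine (hD (polarPoint r θ) ?_).trans ((le_abs_self D).trans (by linarith))
    rw [mem_closedBall_zero_iff, norm_polarPoint, abs_of_pos (hR.trans_le hr)]
    exact hr1

lemma UniformlyQuasianalyticDiskIn.comp_linearIsometry_continuousOn {M : ℝ → ℕ → ℝ}
    {f : Space 2 → ℝ} (hf : UniformlyQuasianalyticDiskIn M f) (U : Space 2 →ₗᵢ[ℝ] Space 2) :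
    ContinuousOn (f ∘ U) (Metric.closedBall 0 1) :=
  hf.1.comp U.continuous.continuousOn (mapsTo_closedBall_of_linearIsometry U)

/-- The difference of two functions of the same quasianalytic classes, one of them possibly turned
or reflected, is again subject to the bounds of quasianalytic classes. -/
lemma UniformlyQuasianalyticDiskIn.hasQuasianalyticAngularBounds_sub {M : ℝ → ℕ → ℝ}
    {f g : Space 2 → ℝ} (hf : UniformlyQuasianalyticDiskIn M f)
    (hg : UniformlyQuasianalyticDiskIn M g) (U : Space 2 →ₗᵢ[ℝ] Space 2) :
    HasQuasianalyticAngularBounds fun x => f x - g (U x) := by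
  intro R hR hR1
  obtain ⟨C, A, hC, hA, hfB⟩ := hf.exists_derivBound hR hR1
  obtain ⟨C', A', hC', hA', hgB⟩ := hg.exists_derivBound hR hR1
  obtain ⟨σ, c, hσ, hU⟩ := exists_map_polarPoint_eq U
  refine ⟨carlemanSeq (M R) (C + C') (max A A'), (hf.2 R hR hR1).1.isDenjoyCarlemanSeq
    (add_pos hC hC') (lt_max_of_lt_left hA), fun r hr hr1 => ?_⟩
  simp only [hU]
  exact ((hfB r hr hr1).sub ((hgB r hr hr1).comp_affine hσ c)).mono
    (carlemanSeq_add_le hC.le hC'.le hA.le hA'.le)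

/-! ### Planar broken rays -/

lemma norm_polarPoint_sub (φ β : ℝ) :
    ‖polarPoint 1 (φ + β) - polarPoint 1 φ‖ = Real.sqrt (2 - 2 * Real.cos β) := by
  rw [eq_comm, Real.sqrt_eq_iff_mul_self_eq (by linarith [Real.cos_le_one β]) (norm_nonneg _),
    ← sq, norm_sq_space_two]
  simp only [PiLp.sub_apply, polarPoint_apply_zero, polarPoint_apply_one, Real.cos_add,
    Real.sin_add]
  linear_combination (-(Real.cos β ^ 2 + Real.sin β ^ 2 + 1 - 2 * Real.cos β)) *
    Real.sin_sq_add_cos_sq φ - Real.sin_sq_add_cos_sq β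

lemma polarPoint_reflection (φ β : ℝ) :
    polarPoint 1 (φ + β + β) - polarPoint 1 (φ + β) =
      (polarPoint 1 (φ + β) - polarPoint 1 φ) -
        (2 * inner ℝ (polarPoint 1 (φ + β) - polarPoint 1 φ) (polarPoint 1 (φ + β))) •
          polarPoint 1 (φ + β) := by
  have h1 : inner ℝ (polarPoint 1 (φ + β) - polarPoint 1 φ) (polarPoint 1 (φ + β)) =
      1 - Real.cos β := by
    rw [PiLp.inner_apply, Fin.sum_univ_two]
    have h2 : Real.cos β = Real.cos (φ + β - φ) := by ring_nf
    rw [h2, Real.cos_sub]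
    simp only [PiLp.sub_apply, polarPoint_apply_zero, polarPoint_apply_one, RCLike.inner_apply,
      conj_trivial]
    linear_combination Real.sin_sq_add_cos_sq (φ + β)
  have hcos : Real.cos φ = Real.cos (φ + β) * Real.cos β + Real.sin (φ + β) * Real.sin β := by
    rw [← Real.cos_sub, add_sub_cancel_right]
  have hsin : Real.sin φ = Real.sin (φ + β) * Real.cos β - Real.cos (φ + β) * Real.sin β := by
    rw [← Real.sin_sub, add_sub_cancel_right]
  rw [h1]
  refine space_two_ext ?_ ?_
  · simp only [PiLp.sub_apply, PiLp.smul_apply, smul_eq_mul, polarPoint_apply_zero]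
    rw [Real.cos_add (φ + β)]
    linear_combination hcos
  · simp only [PiLp.sub_apply, PiLp.smul_apply, smul_eq_mul, polarPoint_apply_one]
    rw [Real.sin_add (φ + β)]
    linear_combination hsin

/-- The point at angle `θ` of the great circle in the plane parametrized by `L`. -/
def circlePoint {n : ℕ} (L : Space 2 →ₗᵢ[ℝ] Space n) (θ : ℝ) : UnitSphere n :=
  ⟨L (polarPoint 1 θ), mem_sphere_zero_iff_norm.mpr (norm_map_polarPoint_one L θ)⟩

lemma continuous_circlePoint {n : ℕ} (L : Space 2 →ₗᵢ[ℝ] Space n) : Continuous (circlePoint L) :=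
  (L.continuous.comp (continuous_polarPoint 1)).subtype_mk _

lemma direction_circlePoint {n : ℕ} (L : Space 2 →ₗᵢ[ℝ] Space n) (φ β : ℝ) :
    direction (circlePoint L φ : Space n) (circlePoint L (φ + β)) =
      (Real.sqrt (2 - 2 * Real.cos β))⁻¹ • L (polarPoint 1 (φ + β) - polarPoint 1 φ) := by
  simp only [direction, circlePoint, ← map_sub, L.norm_map, norm_polarPoint_sub]

/-- In the plane parametrized by `L` the chords of a fixed angle `β` form a broken ray, and its
transform is the sum of the averages over the chords, up to a factor. -/
lemma exists_brokenRay {n : ℕ} {E : Set (UnitSphere n)} (L : Space 2 →ₗᵢ[ℝ] Space n) {β θ : ℝ}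
    (hβ : Real.cos β ≠ 1) {N : ℕ} (hN : 0 < N) (hstart : circlePoint L θ ∈ E)
    (hend : circlePoint L (θ + N * β) ∈ E) :
    ∃ (γ : BrokenRay n E) (c : ℝ), c ≠ 0 ∧ ∀ f : Space n → ℝ, brokenRayTransform f γ =
      c * ∑ k ∈ Finset.range N, chordAverage (f ∘ L) β (θ + k * β) := by
  set l := Real.sqrt (2 - 2 * Real.cos β) with hl
  have hl0 : 0 < l := by
    refine Real.sqrt_pos.mpr ?_
    have := lt_of_le_of_ne (Real.cos_le_one β) hβ
    linarith
  have hsucc (i : ℕ) : θ + ((i + 1 : ℕ) : ℝ) * β = θ + i * β + β := by push_cast; ring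
  have hlen (i : ℕ) : ‖(circlePoint L (θ + ((i + 1 : ℕ) : ℝ) * β) : Space n) -
      circlePoint L (θ + i * β)‖ = l := by
    rw [hsucc, circlePoint, circlePoint, ← map_sub, L.norm_map, norm_polarPoint_sub]
  let γ : BrokenRay n E :=
    { segments := N
      segments_pos := hN
      vertex := fun i => circlePoint L (θ + i * β)
      start_mem := by simpa using hstart
      end_mem := hend
      nondegenerate := fun i _ heq => by
        have := hlen i
        rw [← heq, sub_self, norm_zero] at this
        exact hl0.ne this
      reflection_law := fun i _ => by
        rw [hsucc (i + 1), hsucc i]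
        simp only [direction_circlePoint]
        rw [polarPoint_reflection, map_sub, map_smul]
        simp only [circlePoint]
        rw [real_inner_smul_left, L.inner_map_map, smul_sub, smul_smul]
        congr 2
        ring }
  have hseg (i : ℕ) : γ.segmentLength i = l := hlen i
  refine ⟨γ, 1 / γ.length * l, ?_, fun f => ?_⟩
  · have : γ.length = N * l := by simp [BrokenRay.length, hseg, γ]
    rw [this]
    have : (N : ℝ) ≠ 0 := Nat.cast_ne_zero.mpr hN.ne'
    positivity
  · rw [brokenRayTransform, mul_assoc]
    congr 1
    rw [Finset.mul_sum]
    refine Finset.sum_congr rfl fun k _ => ?_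
    have h1 := intervalIntegral.smul_integral_comp_mul_left (a := 0) (b := 1)
      (fun t => f ((γ.vertex k : Space n) +
        t • direction (γ.vertex k : Space n) (γ.vertex (k + 1)))) l
    rw [mul_zero, mul_one] at h1
    rw [hseg, ← h1, chordAverage_eq_intervalIntegral, smul_eq_mul]
    congr 1
    refine intervalIntegral.integral_congr fun t _ => ?_
    simp only [Function.comp_apply]
    congr 1
    have hdir : direction (γ.vertex k : Space n) (γ.vertex (k + 1)) =
        l⁻¹ • L (polarPoint 1 (θ + k * β + β) - polarPoint 1 (θ + k * β)) := by
      rw [← direction_circlePoint, ← hsucc]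
    have hv : (γ.vertex k : Space n) = L (polarPoint 1 (θ + k * β)) := rfl
    rw [hdir, hv, smul_smul, mul_right_comm, mul_inv_cancel₀ hl0.ne', one_mul, ← map_smul,
      ← map_add, chordPoint]
    congr 1
    module

lemma cos_ne_one_of_irrational {β : ℝ} (hβ : Irrational (β / (2 * Real.pi))) :
    Real.cos β ≠ 1 := by
  intro h
  obtain ⟨k, hk⟩ := (Real.cos_eq_one_iff β).mp h
  refine hβ ⟨k, ?_⟩
  have := Real.pi_pos
  rw [← hk]
  push_cast
  field_simp

lemma chordAverage_sub {f g : Space 2 → ℝ} (hf : ContinuousOn f (Metric.closedBall 0 1))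
    (hg : ContinuousOn g (Metric.closedBall 0 1)) (β φ : ℝ) :
    chordAverage (fun x => f x - g x) β φ = chordAverage f β φ - chordAverage g β φ :=
  integral_sub
    ((continuous_comp_chordPoint hf β φ).integrable_of_hasCompactSupport
      (HasCompactSupport.of_compactSpace _))
    ((continuous_comp_chordPoint hg β φ).integrable_of_hasCompactSupport
      (HasCompactSupport.of_compactSpace _))

lemma exists_plane {n : ℕ} (hn : 2 ≤ n) (x : Space n) {e : Space n} (he : e ≠ 0) :
    ∃ F : Submodule ℝ (Space n), Module.finrank ℝ F = 2 ∧ x ∈ F ∧ e ∈ F := by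
  obtain ⟨v, hv, hx⟩ : ∃ v, LinearIndependent ℝ ![e, v] ∧ x ∈ Submodule.span ℝ {e, v} := by
    by_cases h : ∃ a : ℝ, a • e = x
    · obtain ⟨a, rfl⟩ := h
      obtain ⟨v, hv⟩ := exists_linearIndependent_pair_of_one_lt_finrank
        (R := ℝ) (M := Space n) (by rw [finrank_euclideanSpace_fin]; omega) he
      exact ⟨v, hv, Submodule.smul_mem _ _ (Submodule.subset_span (by simp))⟩
    · push Not at h
      exact ⟨x, (LinearIndependent.pair_iff' he).mpr h, Submodule.subset_span (by simp)⟩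
  refine ⟨Submodule.span ℝ {e, v}, ?_, hx, Submodule.subset_span (by simp)⟩
  rw [← Matrix.range_cons_cons_empty e v ![], finrank_span_eq_card hv, Fintype.card_fin]

/-- Functions of the same quasianalytic classes in every plane through the origin are equal if their
broken ray transforms are. -/
theorem eqOn_of_brokenRayTransform_eq {n : ℕ} (hn : 2 ≤ n) {E : Set (UnitSphere n)}
    (hE : IsOpen E) (hne : E.Nonempty) {M : Submodule ℝ (Space n) → ℝ → ℕ → ℝ}
    {f g : Space n → ℝ} (hf : UniformlyQuasianalyticIn M f) (hg : UniformlyQuasianalyticIn M g)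
    (hfg : ∀ γ : BrokenRay n E, brokenRayTransform f γ = brokenRayTransform g γ) :
    Set.EqOn f g (Metric.closedBall 0 1) := by
  intro x hx
  obtain ⟨e, he⟩ := hne
  have he1 : ‖(e : Space n)‖ = 1 := by simp
  obtain ⟨F, hF, hxF, heF⟩ := exists_plane hn x (e := e) (norm_ne_zero_iff.mp (by simp [he1]))
  obtain ⟨L, hL, hfL⟩ := hf F hF
  obtain ⟨L', hL', hgL⟩ := hg F hF
  obtain ⟨U, hU⟩ := exists_linearIsometry_comp_eq (hL.trans hL'.symm)
  have hgU : (g ∘ L') ∘ U = g ∘ L := funext fun y => by simp [hU]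
  have hfc : ContinuousOn (f ∘ L) (Metric.closedBall 0 1) := hfL.1
  have hgc : ContinuousOn (g ∘ L) (Metric.closedBall 0 1) :=
    hgU ▸ hgL.comp_linearIsometry_continuousOn U
  set h : Space 2 → ℝ := fun y => (f ∘ L) y - (g ∘ L) y with hh
  have hB : HasQuasianalyticAngularBounds h := by
    rw [hh, ← hgU]
    exact hfL.hasQuasianalyticAngularBounds_sub hgL U
  have hhc : ContinuousOn h (Metric.closedBall 0 1) := hfc.sub hgc
  have hzero (β : ℝ) (hβ : Irrational (β / (2 * Real.pi))) (φ : ℝ) : chordAverage h β φ = 0 := by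
    refine chordAverage_eq_zero hhc hB (U := circlePoint L ⁻¹' E)
      (hE.preimage (continuous_circlePoint L)) ?_ (fun θ hθ k => ?_) hβ
      (fun N θ hN hθ hθN => ?_) φ
    · rw [← hL] at heF
      obtain ⟨y, hy⟩ := heF
      obtain ⟨θ, hθ⟩ := exists_eq_polarPoint y
      have hy1 : ‖y‖ = 1 := by rw [← L.norm_map, ← he1, ← hy]; rfl
      refine ⟨θ, ?_⟩
      have : circlePoint L θ = e := Subtype.ext (by rw [← hy, hθ, hy1]; rfl)
      rwa [Set.mem_preimage, this]
    · have : circlePoint L (θ + k * (2 * Real.pi)) = circlePoint L θ :=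
        Subtype.ext (by simp only [circlePoint, polarPoint_add_int_mul_two_pi])
      rwa [Set.mem_preimage, this]
    · obtain ⟨γ, c, hc, hγ⟩ := exists_brokenRay L (cos_ne_one_of_irrational hβ) hN hθ hθN
      have h1 := hfg γ
      rw [hγ, hγ] at h1
      simp only [hh, chordAverage_sub hfc hgc, Finset.sum_sub_distrib]
      exact sub_eq_zero.mpr (mul_left_cancel₀ hc h1)
  rw [← hL] at hxF
  obtain ⟨y, hy⟩ := hxF
  have hy' : L y = x := hy
  have h1 := eq_zero_of_chordAverage_eq_zero hhc hzero y
    (by rw [mem_closedBall_zero_iff, ← L.norm_map, hy']; simpa using hx)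
  simpa [hh, hy', sub_eq_zero] using h1

/-- The zero function belongs to all quasianalytic classes. -/
lemma UniformlyQuasianalyticIn.zero {n : ℕ} {M : Submodule ℝ (Space n) → ℝ → ℕ → ℝ}
    {f : Space n → ℝ} (hf : UniformlyQuasianalyticIn M f) :
    UniformlyQuasianalyticIn M fun _ => 0 := by
  intro F hF
  obtain ⟨L, hL, hfL⟩ := hf F hF
  refine ⟨L, hL, continuousOn_const, fun R hR hR1 => ?_⟩
  obtain ⟨hM, -⟩ := hfL.2 R hR hR1
  have h0 : SeqClassBound (M F R) 1 0 := fun m => by simpa using (hM.pos m).le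
  refine ⟨hM, 1, one_pos, fun r _ _ => ⟨0, 0, ?_, h0, h0⟩⟩
  rw [Metric.tendstoUniformly_iff]
  exact fun ε hε => Eventually.of_forall fun K θ => by simpa using hε

end BrokenRayTomography

end

theorem mainTheorem4 (n : ℕ) (hn : 2 ≤ n)
    (E : Set (BrokenRayTomography.UnitSphere n)) (hE : IsOpen E) (hne : E.Nonempty) :
    (∀ f : BrokenRayTomography.Space n → ℝ,
      BrokenRayTomography.UniformlyQuasianalytic f →
      BrokenRayTomography.AngularDiniLipschitz f →
      (∀ γ : BrokenRayTomography.BrokenRay n E,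
        BrokenRayTomography.brokenRayTransform f γ = 0) →
      ∀ x ∈ Metric.closedBall (0 : BrokenRayTomography.Space n) 1, f x = 0) ∧
    (∀ (M : Submodule ℝ (BrokenRayTomography.Space n) → ℝ → ℕ → ℝ)
      (f g : BrokenRayTomography.Space n → ℝ),
      BrokenRayTomography.UniformlyQuasianalyticIn M f →
      BrokenRayTomography.UniformlyQuasianalyticIn M g →
      BrokenRayTomography.AngularDiniLipschitz f →
      BrokenRayTomography.AngularDiniLipschitz g →
      (∀ γ : BrokenRayTomography.BrokenRay n E,
        BrokenRayTomography.brokenRayTransform f γ =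
          BrokenRayTomography.brokenRayTransform g γ) →
      Set.EqOn f g (Metric.closedBall (0 : BrokenRayTomography.Space n) 1)) := by
  refine ⟨fun f hf _ hG => ?_, fun M f g hf hg _ _ hG =>
    BrokenRayTomography.eqOn_of_brokenRayTransform_eq hn hE hne hf hg hG⟩
  obtain ⟨M, hf⟩ := hf
  refine BrokenRayTomography.eqOn_of_brokenRayTransform_eq hn hE hne hf hf.zero fun γ => ?_
  rw [hG]
  simp [BrokenRayTomography.brokenRayTransform]
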